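/- Let $m,k\ge 0$ with $d:=m+k\ge 1$. Let $\mathcal P\subset\mathbb R^m$ (prices) and $\mathcal C\subset\mathbb R^k$ (contexts) be bounded, let $\mathcal B\subset\mathbb R^d$ (parameters), let $r(p,c;\beta)$ be a real-valued reward function, and let $(c,\beta)\mapsto p_{ce}(c;\beta)$ be a measurable certainty equivalent price, i.e. $p_{ce}(c;\beta)\in\arg\max_{p\in\mathcal P} r(p,c;\beta)$ for all $c\in\mathcal C$ and $\beta\in\mathcal B$. On a probability space with a filtration $(\mathcal F_t)_{t\ge 0}$ ($\mathcal F_t$ is the information available at the end of round $t$), suppose that - the contexts $c_t\in\mathcal C$, $t\ge1$, are i.i.d., $c_t$ is $\mathcal F_t$-measurable, and $\Sigma^c=\mathbb E[c_1c_1^\top]$ is positive definite; - the perturbations $u_t\in\mathbb R^m$, $t\ge1$, are i.i.d., bounded, of mean zero, with positive definite covariance $\Sigma_u=\mathbb E[u_1u_1^\top]$; $u_t$ is $\mathcal F_t$-measurable and independent of $\sigma(\mathcal F_{t-1},c_t)$; - the parameter estimates $\hat\beta_t\in\mathcal B$, $t\ge 0$, are $\mathcal F_t$-measurable and otherwise arbitrary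 (for instance, maximum quasi-likelihood estimates computed from the inputs and responses of rounds $1,\dots,t$). Let $\eta\in[0,1/2)$ and $\alpha_s=s^{-\eta}$, and for $t\ge1$ let $p_t=p_{ce}(c_t;\hat\beta_{t-1})+\alpha_tu_t$ be the perturbed certainty equivalent price and $x_t=(p_t,c_t)\in\mathbb R^d$. Let $\lambda_{\min}(t)$ be the smallest eigenvalue of the design matrix $\sum_{s=1}^t x_sx_s^\top$. Then, almost surely, $\lambda_{\min}(t)=\Omega\big(\sum_{s=1}^t\alpha_s^2\big)$ as $t\to\infty$: there is a deterministic constant $K>0$ such that, with probability $1$, there is a (random) $T_0$ with $$\lambda_{\min}(t)\ \ge\ K\sum_{s=1}^t\alpha_s^2\qquad\text{for all } t\ge T_0 .$$ -/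

import Mathlib

open MeasureTheory ProbabilityTheory Filter
open scoped Matrix

namespace PerturbedPricing

/-- The smallest eigenvalue of a real symmetric matrix of positive size
(its spectrum over `ℝ` is then the finite nonempty set of its eigenvalues). -/
noncomputable def minEigenvalue {n : Type*} [Fintype n] [DecidableEq n]
    (A : Matrix n n ℝ) : ℝ :=
  sInf (spectrum ℝ A)

/-- The matrix `𝔼[v vᵀ]` of a random vector `v`. -/
noncomputable def secondMoment {Ω n : Type*} [MeasurableSpace Ω] (P : Measure Ω)
    (v : Ω → n → ℝ) : Matrix n n ℝ :=
  Matrix.of fun i j => ∫ ω, v ω i * v ω j ∂P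

/-- `pce` is a certainty equivalent price for the reward function `r`: for each context `c ∈ C`
and each parameter `β ∈ B`, the price `pce c β` maximizes `p ↦ r p c β` over the price set. -/
def IsCertaintyEquivalentPrice {m k : ℕ} (prices : Set (Fin m → ℝ)) (contexts : Set (Fin k → ℝ))
    (params : Set (Fin m ⊕ Fin k → ℝ))
    (r : (Fin m → ℝ) → (Fin k → ℝ) → (Fin m ⊕ Fin k → ℝ) → ℝ)
    (pce : (Fin k → ℝ) → (Fin m ⊕ Fin k → ℝ) → (Fin m → ℝ)) : Prop :=
  ∀ c ∈ contexts, ∀ β ∈ params,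
    pce c β ∈ prices ∧ IsMaxOn (fun p => r p c β) prices (pce c β)

/-- The size `α_s = s^{-η}` of the perturbation in round `s ≥ 1`. -/
noncomputable def perturbationSize (η : ℝ) (s : ℕ) : ℝ := (s : ℝ) ^ (-η)

/-- The perturbed certainty equivalent price in round `t ≥ 1`, along one trajectory:
`p_t = p_ce(c_t; β̂_{t-1}) + α_t u_t`. -/
noncomputable def price {m k : ℕ} (η : ℝ)
    (pce : (Fin k → ℝ) → (Fin m ⊕ Fin k → ℝ) → (Fin m → ℝ))
    (c : ℕ → Fin k → ℝ) (u : ℕ → Fin m → ℝ) (βhat : ℕ → Fin m ⊕ Fin k → ℝ) (t : ℕ) :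
    Fin m → ℝ :=
  pce (c t) (βhat (t - 1)) + perturbationSize η t • u t

/-- The input vector `x_t = (p_t, c_t)` in round `t ≥ 1`. -/
noncomputable def input {m k : ℕ} (η : ℝ)
    (pce : (Fin k → ℝ) → (Fin m ⊕ Fin k → ℝ) → (Fin m → ℝ))
    (c : ℕ → Fin k → ℝ) (u : ℕ → Fin m → ℝ) (βhat : ℕ → Fin m ⊕ Fin k → ℝ) (t : ℕ) :
    Fin m ⊕ Fin k → ℝ :=
  Sum.elim (price η pce c u βhat t) (c t)

/-- The design matrix `∑_{s=1}^t x_s x_sᵀ`. -/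
noncomputable def designMatrix {m k : ℕ} (η : ℝ)
    (pce : (Fin k → ℝ) → (Fin m ⊕ Fin k → ℝ) → (Fin m → ℝ))
    (c : ℕ → Fin k → ℝ) (u : ℕ → Fin m → ℝ) (βhat : ℕ → Fin m ⊕ Fin k → ℝ) (t : ℕ) :
    Matrix (Fin m ⊕ Fin k) (Fin m ⊕ Fin k) ℝ :=
  ∑ s ∈ Finset.Icc 1 t,
    Matrix.vecMulVec (input η pce c u βhat s) (input η pce c u βhat s)

/-- The stochastic assumptions of the model. Rounds are numbered `1, 2, …` (the values `c 0` and
`u 0` play no role), and `ℱ t` is the information available at the end of round `t`: contexts,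
perturbations, responses and anything else that the estimate `βhat t` may be computed from.
Since `u` is adapted, `perturbation_indep` makes the perturbations mutually independent. -/
structure IsModel {Ω : Type*} [mΩ : MeasurableSpace Ω] (P : Measure Ω) (ℱ : Filtration ℕ mΩ)
    {m k : ℕ} (contexts : Set (Fin k → ℝ)) (params : Set (Fin m ⊕ Fin k → ℝ))
    (c : ℕ → Ω → Fin k → ℝ) (u : ℕ → Ω → Fin m → ℝ)
    (βhat : ℕ → Ω → Fin m ⊕ Fin k → ℝ) : Prop where
  context_adapted : ∀ t, Measurable[ℱ (t + 1)] (c (t + 1))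
  perturbation_adapted : ∀ t, Measurable[ℱ (t + 1)] (u (t + 1))
  estimate_adapted : ∀ t, Measurable[ℱ t] (βhat t)
  context_mem : ∀ t, ∀ᵐ ω ∂P, c (t + 1) ω ∈ contexts
  estimate_mem : ∀ t, ∀ᵐ ω ∂P, βhat t ω ∈ params
  context_indep : iIndepFun (fun t => c (t + 1)) P
  context_identDistrib : ∀ t, IdentDistrib (c (t + 1)) (c 1) P P
  context_posDef : (secondMoment P (c 1)).PosDef
  perturbation_indep : ∀ t, Indep (MeasurableSpace.comap (u (t + 1)) inferInstance)
    (ℱ t ⊔ MeasurableSpace.comap (c (t + 1)) inferInstance) P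
  perturbation_identDistrib : ∀ t, IdentDistrib (u (t + 1)) (u 1) P P
  perturbation_bounded : ∃ umax : ℝ, ∀ᵐ ω ∂P, ‖u 1 ω‖ ≤ umax
  perturbation_mean_zero : ∀ i, ∫ ω, u 1 ω i ∂P = 0
  perturbation_posDef : (secondMoment P (u 1)).PosDef

end PerturbedPricing

/-! Write `w_s` for the unperturbed input, `S = ∑ α_s²`, and `v = (a, b)` with `a` the price part
and `b` the context part. Since `v·x_s = v·w_s + α_s (a·u_s)`, the quadratic form of the design
matrix is `∑ (v·w_s)² + 2 ∑ α_s (a·u_s)(v·w_s) + ∑ α_s² (a·u_s)²`.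

The last sum is at least about `S lu |a|²`, with `lu > 0` from `Σ_u`. The cross sum is a martingale
with increments `O(α_s)`, hence `o(S)`, however the estimates are chosen
(`ae_isLittleO_weighted_sum_of_indep`). The first sum is nonnegative and at least about `t (lc
|b|²/2 - C² m |a|²)`, with `lc > 0` from `Σ^c`. As `S ≤ t`, it also dominates `θ S` times this
bracket for `θ ≤ 1`; for small `θ` the loss in `|a|²` is absorbed by the perturbation term and a
multiple of `S (|a|² + |b|²)` remains (`le_sum_dotProduct_perturbed_sq`).

Only finitely many matrix entries need a limit law, so the estimates are uniform in `v`. -/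

open Topology Asymptotics

/-! ### Summation lemmas for real sequences. -/

/-- **Kronecker's lemma**, for nonnegative increments `g n` of the normalizing sequence
`∑ k ∈ range (n + 1), g k`. -/
theorem isLittleO_sum_of_tendsto_sum_div {g a : ℕ → ℝ} {l : ℝ} (hg : ∀ n, 0 ≤ g n) (hg0 : 0 < g 0)
    (hgtop : Tendsto (fun n => ∑ k ∈ Finset.range n, g k) atTop atTop)
    (ha : Tendsto (fun n => ∑ k ∈ Finset.range n, a k / ∑ i ∈ Finset.range (k + 1), g i)
      atTop (𝓝 l)) :
    (fun n => ∑ k ∈ Finset.range n, a k) =o[atTop] fun n => ∑ k ∈ Finset.range n, g k := by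
  set S : ℕ → ℝ := fun n => ∑ k ∈ Finset.range n, g k with hS
  set e : ℕ → ℝ := fun n => ∑ k ∈ Finset.range n, a k / S (k + 1) - l with he
  have hSpos : ∀ n, 0 < S (n + 1) := fun n => by
    simp only [hS, Finset.sum_range_succ']
    exact add_pos_of_nonneg_of_pos (Finset.sum_nonneg fun i _ => hg _) hg0
  have he0 : Tendsto e atTop (𝓝 0) := by
    simpa [he] using ha.sub_const l
  -- Summation by parts: `a n = S (n + 1) * (e (n + 1) - e n)`, and `S 0 = 0` kills the boundary
  -- term. Both terms on the right are `o(S)` because `e → 0`.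
  have key : ∀ n, ∑ k ∈ Finset.range n, a k = S n * e n - ∑ k ∈ Finset.range n, g k * e k := by
    intro n
    induction n with
    | zero => simp [hS]
    | succ n ih =>
      have h1 : S (n + 1) = S n + g n := Finset.sum_range_succ _ _
      have h2 : e (n + 1) = e n + a n / S (n + 1) := by
        simp only [he, Finset.sum_range_succ]; ring
      have h3 : S (n + 1) * (a n / S (n + 1)) = a n := mul_div_cancel₀ _ (hSpos n).ne'
      rw [Finset.sum_range_succ, Finset.sum_range_succ, ih, h2, mul_add, h3, h1]
      ring
  have h1 : (fun n => S n * e n) =o[atTop] S := by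
    simpa using (isBigO_refl S atTop).mul_isLittleO ((isLittleO_one_iff ℝ).2 he0)
  have h2 : (fun n => ∑ k ∈ Finset.range n, g k * e k) =o[atTop] S := by
    refine IsLittleO.sum_range ?_ hg hgtop
    simpa using (isBigO_refl g atTop).mul_isLittleO ((isLittleO_one_iff ℝ).2 he0)
  simpa only [key] using h1.sub h2

/-- Discrete analogue of `∫ dS / S²`: the term `k = 0` equals `1`, and the others telescope to at
most `1 / S 1 = 1`. It supplies the square summability of the coefficients `a k / S (k + 1)` when `a
k ^ 2 ≤ g k`. -/
theorem sum_div_sq_partialSum_le {g : ℕ → ℝ} (hg : ∀ n, 0 ≤ g n) (hg0 : g 0 = 1) (n : ℕ) :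
    ∑ k ∈ Finset.range n, g k / (∑ i ∈ Finset.range (k + 1), g i) ^ 2 ≤ 2 := by
  set S : ℕ → ℝ := fun n => ∑ k ∈ Finset.range n, g k with hS
  have hSpos : ∀ n, 0 < S (n + 1) := fun n => by
    simp only [hS, Finset.sum_range_succ', hg0]
    exact add_pos_of_nonneg_of_pos (Finset.sum_nonneg fun i _ => hg _) one_pos
  have key : ∀ n, ∑ k ∈ Finset.range (n + 1), g k / S (k + 1) ^ 2 ≤ 2 - 1 / S (n + 1) := by
    intro n
    induction n with
    | zero => simp [hS, hg0]; norm_num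
    | succ n ih =>
      rw [Finset.sum_range_succ]
      have h1 : S (n + 1 + 1) = S (n + 1) + g (n + 1) := Finset.sum_range_succ _ _
      have h2 := hSpos n
      have h3 := hSpos (n + 1)
      have h4 : g (n + 1) / S (n + 1 + 1) ^ 2 ≤ 1 / S (n + 1) - 1 / S (n + 1 + 1) := by
        rw [div_sub_div _ _ h2.ne' h3.ne', div_le_div_iff₀ (by positivity) (by positivity)]
        have h5 := hg (n + 1)
        have : S (n + 1) ≤ S (n + 1 + 1) := by linarith
        have h6 : g (n + 1) * S (n + 1 + 1) * S (n + 1) ≤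
          g (n + 1) * S (n + 1 + 1) * S (n + 1 + 1) := by gcongr
        nlinarith
      linarith
  cases n with
  | zero => simp
  | succ n => exact (key n).trans (by have := hSpos n; simp; positivity)

/-! ### Martingale convergence and a weighted strong law. -/

section
variable {Ω : Type*} [mΩ : MeasurableSpace Ω] {P : Measure Ω} [IsProbabilityMeasure P]
  {ℱ : Filtration ℕ mΩ} {𝒢 : ℕ → MeasurableSpace Ω} {w z : ℕ → Ω → ℝ} {C D : ℝ}

/-- Almost sure convergence of a series of bounded martingale differences `b n * w n * z n`
with square summable coefficients `b n`. -/
theorem ae_tendsto_sum_of_indep (h𝒢 : ∀ n, ℱ n ≤ 𝒢 n) (h𝒢' : ∀ n, 𝒢 n ≤ ℱ (n + 1))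
    (hw : ∀ n, Measurable[𝒢 n] (w n)) (hz : ∀ n, Measurable[ℱ (n + 1)] (z n))
    (hind : ∀ n, Indep (MeasurableSpace.comap (z n) inferInstance) (𝒢 n) P)
    (hwC : ∀ n, ∀ᵐ ω ∂P, |w n ω| ≤ C) (hzD : ∀ n, ∀ᵐ ω ∂P, |z n ω| ≤ D)
    (hz0 : ∀ n, ∫ ω, z n ω ∂P = 0) {b : ℕ → ℝ} {R : ℝ}
    (hb : ∀ n, ∑ k ∈ Finset.range n, b k ^ 2 ≤ R) :
    ∀ᵐ ω ∂P, ∃ l, Tendsto (fun n => ∑ k ∈ Finset.range n, b k * (w k ω * z k ω)) atTop (𝓝 l) := by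
  set f : ℕ → Ω → ℝ := fun n ω => ∑ k ∈ Finset.range n, b k * (w k ω * z k ω) with hf
  have hle : ∀ n, 𝒢 n ≤ mΩ := fun n => (h𝒢' n).trans (ℱ.le _)
  have hwm : ∀ n, Measurable (w n) := fun n => (hw n).mono (hle n) le_rfl
  have hzm : ∀ n, Measurable (z n) := fun n => (hz n).mono (ℱ.le _) le_rfl
  have hw8 : ∀ n, MemLp (w n) ⊤ P := fun n =>
    memLp_top_of_bound (hwm n).aestronglyMeasurable C (hwC n)
  have hz8 : ∀ n, MemLp (z n) ⊤ P := fun n =>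
    memLp_top_of_bound (hzm n).aestronglyMeasurable D (hzD n)
  have mul8 : ∀ {x y : Ω → ℝ}, MemLp x ⊤ P → MemLp y ⊤ P → MemLp (fun ω => x ω * y ω) ⊤ P :=
    fun hx hy => MemLp.mul hy hx
  have hwz8 : ∀ n, MemLp (fun ω => w n ω * z n ω) ⊤ P := fun n => mul8 (hw8 n) (hz8 n)
  have hf8 : ∀ n, MemLp (f n) ⊤ P := fun n =>
    memLp_finsetSum _ fun k _ => (hwz8 k).const_mul (b k)
  have int8 : ∀ {x : Ω → ℝ}, MemLp x ⊤ P → Integrable x P := fun hx => hx.integrable le_top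
  have hadp : ∀ n, Measurable[ℱ n] (f n) := fun n => by
    refine Finset.measurable_sum _ fun k hk => ?_
    have hk' : k + 1 ≤ n := Finset.mem_range.1 hk
    exact ((((hw k).mono (h𝒢' k) le_rfl).mul (hz k)).const_mul (b k)).mono (ℱ.mono hk') le_rfl
  have hmart : Martingale f ℱ P := by
    refine martingale_of_condExp_sub_eq_zero_nat (fun n => (hadp n).stronglyMeasurable)
      (fun n => int8 (hf8 n)) fun n => ?_
    have h1 : f (n + 1) - f n = b n • (w n * z n) := by
      ext ω; simp [hf, Finset.sum_range_succ]
    have h2 : P[w n * z n | 𝒢 n] =ᵐ[P] 0 := by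
      refine (condExp_mul_of_stronglyMeasurable_left (hw n).stronglyMeasurable
        (int8 (hwz8 n)) (int8 (hz8 n))).trans ?_
      have := condExp_indep_eq (hzm n).comap_le (hle n)
        (comap_measurable (z n)).stronglyMeasurable (hind n)
      filter_upwards [this] with ω hω
      simp [hω, hz0]
    -- Tower property: `w n` need only be known at the intermediate stage `𝒢 n`, after the context
    -- and before the perturbation.
    have h3 : P[w n * z n | ℱ n] =ᵐ[P] 0 := by
      refine (condExp_condExp_of_le (h𝒢 n) (hle n)).symm.trans ?_
      refine (condExp_congr_ae h2).trans ?_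
      rw [condExp_zero]
    rw [h1]
    refine (condExp_smul (b n) _ _).trans ?_
    filter_upwards [h3] with ω hω
    simp [hω]
  -- Martingale increments are orthogonal, so second moments add up; Doob's theorem then applies
  -- through `|x| ≤ 1 + x²`.
  have hL2 : ∀ n, ∫ ω, f n ω ^ 2 ∂P ≤ (C * D) ^ 2 * ∑ k ∈ Finset.range n, b k ^ 2 := by
    intro n
    induction n with
    | zero => simp [hf]
    | succ n ih =>
      have h1 : ∀ ω, f (n + 1) ω ^ 2 = f n ω ^ 2 + 2 * b n * (f n ω * w n ω * z n ω) +
          b n ^ 2 * (w n ω * z n ω) ^ 2 := fun ω => by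
        simp only [hf, Finset.sum_range_succ]; ring
      have h2 : ∫ ω, f n ω * w n ω * z n ω ∂P = 0 := by
        have hm : Measurable[𝒢 n] fun ω => f n ω * w n ω :=
          ((hadp n).mono (h𝒢 n) le_rfl).mul (hw n)
        have hi : IndepFun (fun ω => f n ω * w n ω) (z n) P :=
          indep_of_indep_of_le_left (hind n).symm hm.comap_le
        have := hi.integral_mul_eq_mul_integral
          (hm.mono (hle n) le_rfl).aestronglyMeasurable (hzm n).aestronglyMeasurable
        simpa [hz0] using this
      have h3 : ∫ ω, (w n ω * z n ω) ^ 2 ∂P ≤ (C * D) ^ 2 := by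
        have hbd : ∀ᵐ ω ∂P, (w n ω * z n ω) ^ 2 ≤ (C * D) ^ 2 := by
          filter_upwards [hwC n, hzD n] with ω h h'
          rw [← sq_abs, abs_mul]
          have := (abs_nonneg _).trans h
          gcongr
        calc _ ≤ ∫ _, (C * D) ^ 2 ∂P := by
              refine integral_mono_ae ?_ (integrable_const _) hbd
              simpa only [sq] using int8 (mul8 (hwz8 n) (hwz8 n))
          _ = _ := by simp
      have i1 : Integrable (fun ω => f n ω ^ 2) P := by
        simpa only [sq] using int8 (mul8 (hf8 n) (hf8 n))
      have i2 : Integrable (fun ω => 2 * b n * (f n ω * w n ω * z n ω)) P :=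
        (int8 (mul8 (mul8 (hf8 n) (hw8 n)) (hz8 n))).const_mul _
      have i3 : Integrable (fun ω => b n ^ 2 * (w n ω * z n ω) ^ 2) P := by
        refine Integrable.const_mul ?_ _
        simpa only [sq] using int8 (mul8 (hwz8 n) (hwz8 n))
      simp_rw [h1]
      have i12 : Integrable (fun ω => f n ω ^ 2 + 2 * b n * (f n ω * w n ω * z n ω)) P := i1.add i2
      rw [integral_add i12 i3, integral_add i1 i2, integral_const_mul, integral_const_mul,
        h2, Finset.sum_range_succ, mul_add, mul_zero, add_zero]
      have := mul_le_mul_of_nonneg_left h3 (sq_nonneg (b n))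
      linarith
  refine hmart.submartingale.exists_ae_tendsto_of_bdd
    (R := (1 + (C * D) ^ 2 * R).toNNReal) fun n => ?_
  have i1 : Integrable (fun ω => f n ω ^ 2) P := by
    simpa only [sq] using int8 (mul8 (hf8 n) (hf8 n))
  have h1 : ∫ ω, ‖f n ω‖ ∂P ≤ 1 + (C * D) ^ 2 * R := by
    calc ∫ ω, ‖f n ω‖ ∂P ≤ ∫ ω, (1 + f n ω ^ 2) ∂P := by
          refine integral_mono (int8 (hf8 n)).norm ((integrable_const _).add i1) fun ω => ?_
          simp only [Real.norm_eq_abs]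
          nlinarith [sq_abs (f n ω), sq_nonneg (|f n ω| - 1), abs_nonneg (f n ω)]
      _ = 1 + ∫ ω, f n ω ^ 2 ∂P := by rw [integral_add (integrable_const _) i1]; simp
      _ ≤ _ := by
          have := mul_le_mul_of_nonneg_left (hb n) (sq_nonneg (C * D))
          linarith [hL2 n]
  rw [eLpNorm_one_eq_lintegral_enorm, ← ofReal_integral_norm_eq_lintegral_enorm (int8 (hf8 n))]
  exact ENNReal.ofReal_le_ofReal h1

/-- A weighted strong law of large numbers for bounded martingale differences `w n * z n`. -/
theorem ae_isLittleO_weighted_sum_of_indep (h𝒢 : ∀ n, ℱ n ≤ 𝒢 n) (h𝒢' : ∀ n, 𝒢 n ≤ ℱ (n + 1))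
    (hw : ∀ n, Measurable[𝒢 n] (w n)) (hz : ∀ n, Measurable[ℱ (n + 1)] (z n))
    (hind : ∀ n, Indep (MeasurableSpace.comap (z n) inferInstance) (𝒢 n) P)
    (hwC : ∀ n, ∀ᵐ ω ∂P, |w n ω| ≤ C) (hzD : ∀ n, ∀ᵐ ω ∂P, |z n ω| ≤ D)
    (hz0 : ∀ n, ∫ ω, z n ω ∂P = 0) {a g : ℕ → ℝ} (hg : ∀ n, 0 ≤ g n) (hg0 : g 0 = 1)
    (hag : ∀ n, a n ^ 2 ≤ g n)
    (hgtop : Tendsto (fun n => ∑ k ∈ Finset.range n, g k) atTop atTop) :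
    ∀ᵐ ω ∂P, (fun n => ∑ k ∈ Finset.range n, a k * (w k ω * z k ω)) =o[atTop]
      fun n => ∑ k ∈ Finset.range n, g k := by
  have hb : ∀ n, ∑ k ∈ Finset.range n, (a k / ∑ i ∈ Finset.range (k + 1), g i) ^ 2 ≤ 2 := fun n =>
    (Finset.sum_le_sum fun k _ => by
      rw [div_pow]; exact div_le_div_of_nonneg_right (hag k) (sq_nonneg _)).trans
      (sum_div_sq_partialSum_le hg hg0 n)
  filter_upwards [ae_tendsto_sum_of_indep h𝒢 h𝒢' hw hz hind hwC hzD hz0 hb] with ω ⟨l, hl⟩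
  refine isLittleO_sum_of_tendsto_sum_div (l := l) hg (by simp [hg0]) hgtop ?_
  simpa only [div_mul_eq_mul_div] using hl

end

/-! ### Quadratic forms and smallest eigenvalues. -/

section
variable {m n : Type*} [Fintype m] [Fintype n]

/-- Compactness of the unit sphere gives a positive minimum. The sphere is that of the sup norm,
hence the factor `Fintype.card n` when passing to the sum of squares. -/
theorem Matrix.PosDef.exists_pos_mul_sum_sq_le {A : Matrix n n ℝ} (hA : A.PosDef) :
    ∃ l : ℝ, 0 < l ∧ ∀ v : n → ℝ, l * ∑ i, v i ^ 2 ≤ ∑ i, ∑ j, v i * v j * A i j := by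
  have hq : ∀ v : n → ℝ, v ⬝ᵥ A *ᵥ v = ∑ i, ∑ j, v i * v j * A i j := fun v => by
    simp only [dotProduct, Matrix.mulVec, Finset.mul_sum]
    exact Finset.sum_congr rfl fun i _ => Finset.sum_congr rfl fun j _ => by ring
  simp only [← hq]
  cases isEmpty_or_nonempty n with
  | inl h => exact ⟨1, one_pos, fun v => by simp [dotProduct]⟩
  | inr h =>
    have hcont : Continuous fun v : n → ℝ => v ⬝ᵥ A *ᵥ v := by fun_prop
    obtain ⟨v₀, hv₀, hmin⟩ := (isCompact_sphere (0 : n → ℝ) 1).exists_isMinOn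
      (NormedSpace.sphere_nonempty.2 zero_le_one) hcont.continuousOn
    have hv₀' : v₀ ≠ 0 := by
      rintro rfl; simp at hv₀
    set μ := v₀ ⬝ᵥ A *ᵥ v₀ with hμ
    have hμ0 : 0 < μ := by simpa using hA.dotProduct_mulVec_pos hv₀'
    have hcard : (0 : ℝ) < Fintype.card n := by exact_mod_cast Fintype.card_pos
    refine ⟨μ / Fintype.card n, by positivity, fun v => ?_⟩
    have h1 : ∑ i, v i ^ 2 ≤ Fintype.card n * ‖v‖ ^ 2 := by
      calc ∑ i, v i ^ 2 ≤ ∑ _i : n, ‖v‖ ^ 2 := Finset.sum_le_sum fun i _ => by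
            rw [← sq_abs, ← Real.norm_eq_abs]; gcongr; exact norm_le_pi_norm v i
        _ = _ := by simp
    have h2 : μ * ‖v‖ ^ 2 ≤ v ⬝ᵥ A *ᵥ v := by
      by_cases hv : v = 0
      · simp [hv]
      have hv' : 0 < ‖v‖ := norm_pos_iff.2 hv
      have h3 : μ ≤ (‖v‖⁻¹ • v) ⬝ᵥ A *ᵥ (‖v‖⁻¹ • v) := hmin (by simp [norm_smul, hv])
      rw [Matrix.mulVec_smul, smul_dotProduct, dotProduct_smul, smul_eq_mul, smul_eq_mul] at h3
      calc μ * ‖v‖ ^ 2 ≤ (‖v‖⁻¹ * (‖v‖⁻¹ * v ⬝ᵥ A *ᵥ v)) * ‖v‖ ^ 2 := by gcongr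
        _ = _ := by field_simp
    calc μ / Fintype.card n * ∑ i, v i ^ 2
        ≤ μ / Fintype.card n * (Fintype.card n * ‖v‖ ^ 2) := by gcongr
      _ = μ * ‖v‖ ^ 2 := by field_simp
      _ ≤ _ := h2

theorem PerturbedPricing.le_minEigenvalue [DecidableEq n] [Nonempty n] {A : Matrix n n ℝ}
    (hA : A.IsHermitian) {K : ℝ} (h : ∀ v : n → ℝ, K * ∑ i, v i ^ 2 ≤ v ⬝ᵥ A *ᵥ v) :
    K ≤ PerturbedPricing.minEigenvalue A := by
  rw [PerturbedPricing.minEigenvalue, hA.spectrum_real_eq_range_eigenvalues]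
  refine le_csInf (Set.range_nonempty _) ?_
  rintro _ ⟨i, rfl⟩
  have h1 := h (hA.eigenvectorBasis i)
  have h2 : ∑ j, (hA.eigenvectorBasis i) j ^ 2 = 1 := by
    rw [← EuclideanSpace.real_norm_sq_eq, hA.eigenvectorBasis.orthonormal.1 i, one_pow]
  rw [hA.mulVec_eigenvectorBasis, dotProduct_smul] at h1
  have h3 : (hA.eigenvectorBasis i : n → ℝ) ⬝ᵥ (hA.eigenvectorBasis i) = 1 := by
    rw [← h2]; simp [dotProduct, sq]
  rw [h3, h2] at h1
  simpa using h1

/-- Turns entrywise error bounds into bounds uniform in the direction. -/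
theorem abs_sum_sum_mul_le {N : m → n → ℝ} {ε : ℝ} (hN : ∀ i j, |N i j| ≤ ε) (a : m → ℝ)
    (b : n → ℝ) : |∑ i, ∑ j, a i * b j * N i j| ≤ ε * ((∑ i, |a i|) * ∑ j, |b j|) := by
  rw [Finset.sum_mul_sum, Finset.mul_sum]
  refine (Finset.abs_sum_le_sum_abs _ _).trans (Finset.sum_le_sum fun i _ => ?_)
  rw [Finset.mul_sum]
  refine (Finset.abs_sum_le_sum_abs _ _).trans (Finset.sum_le_sum fun j _ => ?_)
  rw [abs_mul, abs_mul, mul_comm]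
  gcongr
  exact hN i j

theorem sum_mul_dotProduct_mul_dotProduct (s : Finset ℕ) (r : ℕ → ℝ) (f : ℕ → m → ℝ)
    (g : ℕ → n → ℝ) (a : m → ℝ) (b : n → ℝ) :
    ∑ t ∈ s, r t * ((a ⬝ᵥ f t) * (b ⬝ᵥ g t)) =
      ∑ i, ∑ j, a i * b j * ∑ t ∈ s, r t * (f t i * g t j) := by
  have h : ∀ t, r t * ((a ⬝ᵥ f t) * (b ⬝ᵥ g t)) =
      ∑ i, ∑ j, r t * ((a i * f t i) * (b j * g t j)) := fun t => by
    simp only [dotProduct]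
    rw [Finset.sum_mul_sum, Finset.mul_sum]
    simp only [Finset.mul_sum]
  simp only [h, Finset.mul_sum]
  rw [Finset.sum_comm]
  refine Finset.sum_congr rfl fun i _ => ?_
  rw [Finset.sum_comm]
  exact Finset.sum_congr rfl fun j _ => Finset.sum_congr rfl fun t _ => by ring

/-- If the weighted empirical second moments of `f` are close to `A`, then the associated
quadratic form is bounded below in terms of a lower bound for `A`. -/
theorem le_sum_mul_dotProduct_sq {s : Finset ℕ} {r : ℕ → ℝ} {f : ℕ → m → ℝ} {A : Matrix m m ℝ}
    {l ε : ℝ} (hl : ∀ a : m → ℝ, l * ∑ i, a i ^ 2 ≤ ∑ i, ∑ j, a i * a j * A i j)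
    (hr : 0 ≤ ∑ t ∈ s, r t)
    (hε : ∀ i j, |∑ t ∈ s, r t * (f t i * f t j - A i j)| ≤ ε) (a : m → ℝ) :
    (∑ t ∈ s, r t) * (l * ∑ i, a i ^ 2) - ε * (∑ i, |a i|) ^ 2 ≤
      ∑ t ∈ s, r t * (a ⬝ᵥ f t) ^ 2 := by
  have h1 : ∑ t ∈ s, r t * (a ⬝ᵥ f t) ^ 2 = (∑ t ∈ s, r t) * ∑ i, ∑ j, a i * a j * A i j +
      ∑ i, ∑ j, a i * a j * ∑ t ∈ s, r t * (f t i * f t j - A i j) := by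
    simp only [sq, sum_mul_dotProduct_mul_dotProduct]
    rw [Finset.mul_sum, ← Finset.sum_add_distrib]
    refine Finset.sum_congr rfl fun i _ => ?_
    rw [Finset.mul_sum, ← Finset.sum_add_distrib]
    refine Finset.sum_congr rfl fun j _ => ?_
    simp only [mul_sub, Finset.sum_sub_distrib, ← Finset.sum_mul]
    ring
  have h2 := (abs_le.1 (abs_sum_sum_mul_le hε a a)).1
  have h3 := mul_le_mul_of_nonneg_left (hl a) hr
  rw [h1, sq]
  linarith

end

/-! ### Deterministic lower bound for the design matrix. -/

section
variable {m k : ℕ}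

/-- Quantitative lower bound for the quadratic form of the design matrix of the inputs
`w t + α t • (u t, 0)`. -/
theorem le_sum_dotProduct_perturbed_sq {U : Matrix (Fin m) (Fin m) ℝ}
    {V : Matrix (Fin k) (Fin k) ℝ} {lu lc C : ℝ} (hlu0 : 0 < lu) (hlc0 : 0 < lc)
    (hlu : ∀ a : Fin m → ℝ, lu * ∑ i, a i ^ 2 ≤ ∑ i, ∑ j, a i * a j * U i j)
    (hlc : ∀ a : Fin k → ℝ, lc * ∑ i, a i ^ 2 ≤ ∑ i, ∑ j, a i * a j * V i j) :
    ∃ K : ℝ, 0 < K ∧ ∀ (α : ℕ → ℝ) (u : ℕ → Fin m → ℝ) (w : ℕ → Fin m ⊕ Fin k → ℝ) (δ : ℝ) (n : ℕ),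
      0 ≤ δ → (∀ t i, |w t (.inl i)| ≤ C) → ∑ t ∈ Finset.range n, α t ^ 2 ≤ n →
      (∀ i j, |∑ t ∈ Finset.range n, α t * (u t i * w t j)| ≤
        δ * ∑ t ∈ Finset.range n, α t ^ 2) →
      (∀ i j, |∑ t ∈ Finset.range n, α t ^ 2 * (u t i * u t j - U i j)| ≤
        δ * ∑ t ∈ Finset.range n, α t ^ 2) →
      (∀ i j, |∑ t ∈ Finset.range n, (w t (.inr i) * w t (.inr j) - V i j)| ≤ δ * n) →
      ∀ v : Fin m ⊕ Fin k → ℝ,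
        (K - 4 * δ * (m + k)) * (∑ t ∈ Finset.range n, α t ^ 2) * ∑ i, v i ^ 2 ≤
          ∑ t ∈ Finset.range n, (v ⬝ᵥ w t + α t * ((v ∘ Sum.inl) ⬝ᵥ u t)) ^ 2 := by
  -- `θ` is small enough that the price loss `θ C² m |a|²` costs at most half of `lu |a|²`; the `+
  -- 1` keeps the denominator positive.
  set θ := min 1 (lu / (2 * (C ^ 2 * m + 1))) with hθ
  have hθ0 : 0 < θ := lt_min one_pos (by positivity)
  have hθ1 : θ ≤ 1 := min_le_left _ _
  have hθC : θ * (C ^ 2 * m) ≤ lu / 2 := by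
    calc θ * (C ^ 2 * m) ≤ lu / (2 * (C ^ 2 * m + 1)) * (C ^ 2 * m + 1) := by
          gcongr
          · exact min_le_right _ _
          · linarith
      _ = lu / 2 := by field_simp
  set K := min (lu / 2) (θ * lc / 2) with hK
  refine ⟨K, lt_min (by positivity) (by positivity), ?_⟩
  intro α u w δ n hδ hC hSn hN hU hc v
  set S := ∑ t ∈ Finset.range n, α t ^ 2 with hS
  have hS0 : 0 ≤ S := Finset.sum_nonneg fun _ _ => sq_nonneg _
  set a : Fin m → ℝ := v ∘ Sum.inl with ha
  set b : Fin k → ℝ := v ∘ Sum.inr with hb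
  set A := ∑ i, a i ^ 2 with hA
  set B := ∑ i, b i ^ 2 with hB
  have hA0 : 0 ≤ A := Finset.sum_nonneg fun _ _ => sq_nonneg _
  have hB0 : 0 ≤ B := Finset.sum_nonneg fun _ _ => sq_nonneg _
  have hQ : ∑ i, v i ^ 2 = A + B := Fintype.sum_sum_type _
  have hL : ∑ i, |v i| = ∑ i, |a i| + ∑ i, |b i| := Fintype.sum_sum_type _
  have hLa0 : 0 ≤ ∑ i, |a i| := Finset.sum_nonneg fun _ _ => abs_nonneg _
  have hLb0 : 0 ≤ ∑ i, |b i| := Finset.sum_nonneg fun _ _ => abs_nonneg _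
  set E := (m + k : ℝ) * (A + B) with hE
  have hE0 : 0 ≤ E := by positivity
  have hLE : (∑ i, |v i|) ^ 2 ≤ E := by
    have := sq_sum_le_card_mul_sum_sq (s := Finset.univ) (f := fun i => |v i|)
    simpa [hQ] using this
  have hLa : (∑ i, |a i|) ^ 2 ≤ E := by
    refine le_trans ?_ hLE; rw [hL]; gcongr; linarith
  have hLb : (∑ i, |b i|) ^ 2 ≤ E := by
    refine le_trans ?_ hLE; rw [hL]; gcongr; linarith
  have hLav : (∑ i, |a i|) * ∑ i, |v i| ≤ E := by
    refine le_trans ?_ hLE; rw [sq]; gcongr; linarith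
  have hcross : -(δ * S * E) ≤ ∑ t ∈ Finset.range n, α t * ((a ⬝ᵥ u t) * (v ⬝ᵥ w t)) := by
    rw [sum_mul_dotProduct_mul_dotProduct]
    refine le_trans (neg_le_neg ?_) (abs_le.1 (abs_sum_sum_mul_le hN a v)).1
    gcongr
  have hpert : S * (lu * A) - δ * S * E ≤ ∑ t ∈ Finset.range n, α t ^ 2 * (a ⬝ᵥ u t) ^ 2 := by
    refine le_trans (sub_le_sub_left ?_ _) (le_sum_mul_dotProduct_sq hlu hS0 hU a)
    gcongr
  have hctx : n * (lc * B) - δ * n * E ≤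
      ∑ t ∈ Finset.range n, (b ⬝ᵥ fun j => w t (.inr j)) ^ 2 := by
    have := le_sum_mul_dotProduct_sq (s := Finset.range n) (r := fun _ => 1)
      (f := fun t j => w t (.inr j)) hlc (by simp) (by simpa using hc) b
    simp only [one_mul, Finset.sum_const, Finset.card_range, nsmul_eq_mul, mul_one] at this
    refine le_trans (sub_le_sub_left ?_ _) this
    gcongr
  have hprice : ∀ t, (a ⬝ᵥ fun i => w t (.inl i)) ^ 2 ≤ A * (C ^ 2 * m) := fun t => by
    refine (Finset.sum_mul_sq_le_sq_mul_sq _ _ _).trans ?_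
    gcongr
    calc ∑ i, w t (.inl i) ^ 2 ≤ ∑ _i : Fin m, C ^ 2 := Finset.sum_le_sum fun i _ => by
          rw [← sq_abs]; gcongr; exact hC t i
      _ = C ^ 2 * m := by simp [mul_comm]
  have hY0 : 0 ≤ ∑ t ∈ Finset.range n, (v ⬝ᵥ w t) ^ 2 := Finset.sum_nonneg fun _ _ => sq_nonneg _
  -- `X` bounds the average of `(v·w_t)²` from below, via `(x + y)² ≥ y²/2 - x²` with `x` the price
  -- part and `y` the context part.
  set X := lc * B / 2 - δ * E / 2 - A * (C ^ 2 * m) with hX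
  have hY : n * X ≤ ∑ t ∈ Finset.range n, (v ⬝ᵥ w t) ^ 2 := by
    have h1 : ∀ t, (b ⬝ᵥ fun j => w t (.inr j)) ^ 2 / 2 - A * (C ^ 2 * m) ≤ (v ⬝ᵥ w t) ^ 2 := by
      intro t
      have h2 : v ⬝ᵥ w t = (a ⬝ᵥ fun i => w t (.inl i)) + (b ⬝ᵥ fun j => w t (.inr j)) :=
        Fintype.sum_sum_type _
      have h3 := hprice t
      rw [h2]
      nlinarith [sq_nonneg (2 * (a ⬝ᵥ fun i => w t (.inl i)) + (b ⬝ᵥ fun j => w t (.inr j)))]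
    have h2 := Finset.sum_le_sum fun t (_ : t ∈ Finset.range n) => h1 t
    rw [Finset.sum_sub_distrib, ← Finset.sum_div] at h2
    simp only [Finset.sum_const, Finset.card_range, nsmul_eq_mul] at h2
    refine le_trans ?_ h2
    rw [hX]
    linarith
  -- Replacing the factor `n` by the smaller `θ * S` is legitimate if `X ≥ 0`; otherwise the left
  -- side is nonpositive.
  have hYX : θ * S * X ≤ ∑ t ∈ Finset.range n, (v ⬝ᵥ w t) ^ 2 := by
    rcases le_or_gt 0 X with h | h
    · refine le_trans ?_ hY
      gcongr
      calc θ * S ≤ 1 * n := by gcongr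
        _ = n := one_mul _
    · exact (mul_nonpos_of_nonneg_of_nonpos (by positivity) h.le).trans hY0
  have hexp : ∑ t ∈ Finset.range n, (v ⬝ᵥ w t + α t * (a ⬝ᵥ u t)) ^ 2 =
      ∑ t ∈ Finset.range n, (v ⬝ᵥ w t) ^ 2 +
      2 * ∑ t ∈ Finset.range n, α t * ((a ⬝ᵥ u t) * (v ⬝ᵥ w t)) +
      ∑ t ∈ Finset.range n, α t ^ 2 * (a ⬝ᵥ u t) ^ 2 := by
    rw [Finset.mul_sum, ← Finset.sum_add_distrib, ← Finset.sum_add_distrib]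
    exact Finset.sum_congr rfl fun t _ => by ring
  -- Errors: `δE/2` at most from `θ X`, `δE` from the perturbations, `2δE` from the cross term;
  -- together below `4δE`.
  have hmain : K * (A + B) - 4 * (δ * E) ≤ θ * X + lu * A - δ * E - 2 * (δ * E) := by
    have h1 : K * A ≤ lu / 2 * A := mul_le_mul_of_nonneg_right (min_le_left _ _) hA0
    have h2 : K * B ≤ θ * lc / 2 * B := mul_le_mul_of_nonneg_right (min_le_right _ _) hB0
    have h3 := mul_le_mul_of_nonneg_right hθC hA0
    have h4 : θ * (δ * E) ≤ 1 * (δ * E) := by gcongr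
    have h5 : 0 ≤ δ * E := by positivity
    have h6 : θ * X = θ * lc / 2 * B - θ * (δ * E) / 2 - θ * (C ^ 2 * m) * A := by rw [hX]; ring
    linarith
  have h7 := mul_le_mul_of_nonneg_left hmain hS0
  rw [hexp, hQ]
  calc (K - 4 * δ * (m + k)) * S * (A + B) = S * (K * (A + B) - 4 * (δ * E)) := by rw [hE]; ring
    _ ≤ _ := h7
    _ ≤ _ := by linarith

/-- Asymptotic lower bound for the quadratic form of the design matrix of the inputs
`w t + α t • (u t, 0)`. -/
theorem eventually_le_sum_dotProduct_perturbed_sq {U : Matrix (Fin m) (Fin m) ℝ}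
    {V : Matrix (Fin k) (Fin k) ℝ} (hu : U.PosDef) (hc : V.PosDef) (C : ℝ) :
    ∃ K : ℝ, 0 < K ∧ ∀ (α : ℕ → ℝ) (u : ℕ → Fin m → ℝ) (w : ℕ → Fin m ⊕ Fin k → ℝ),
      (∀ t i, |w t (.inl i)| ≤ C) → (∀ t, α t ^ 2 ≤ 1) →
      (∀ i j, (fun n => ∑ t ∈ Finset.range n, α t * (u t i * w t j)) =o[atTop]
        fun n => ∑ t ∈ Finset.range n, α t ^ 2) →
      (∀ i j, (fun n => ∑ t ∈ Finset.range n, α t ^ 2 * (u t i * u t j - U i j)) =o[atTop]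
        fun n => ∑ t ∈ Finset.range n, α t ^ 2) →
      (∀ i j, (fun n => ∑ t ∈ Finset.range n, (w t (.inr i) * w t (.inr j) - V i j)) =o[atTop]
        fun n => (n : ℝ)) →
      ∀ᶠ n in atTop, ∀ v : Fin m ⊕ Fin k → ℝ,
        K * (∑ t ∈ Finset.range n, α t ^ 2) * ∑ i, v i ^ 2 ≤
          ∑ t ∈ Finset.range n, (v ⬝ᵥ w t + α t * ((v ∘ Sum.inl) ⬝ᵥ u t)) ^ 2 := by
  obtain ⟨lu, hlu0, hlu⟩ := hu.exists_pos_mul_sum_sq_le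
  obtain ⟨lc, hlc0, hlc⟩ := hc.exists_pos_mul_sum_sq_le
  obtain ⟨K, hK, H⟩ := le_sum_dotProduct_perturbed_sq (C := C) hlu0 hlc0 hlu hlc
  refine ⟨K / 2, half_pos hK, fun α u w hC hα hN hU hcc => ?_⟩
  -- Chosen so that `4 δ (m + k) ≤ K / 2`.
  set δ : ℝ := K / (8 * (m + k + 1)) with hδ
  have hδ0 : 0 < δ := by positivity
  have hδK : K / 2 ≤ K - 4 * δ * (m + k) := by
    have : 8 * (δ * (m + k + 1)) = K := by rw [hδ]; field_simp
    linarith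
  have h1 := eventually_all.2 fun i => eventually_all.2 fun j => (hN i j).bound hδ0
  have h2 := eventually_all.2 fun i => eventually_all.2 fun j => (hU i j).bound hδ0
  have h3 := eventually_all.2 fun i => eventually_all.2 fun j => (hcc i j).bound hδ0
  filter_upwards [h1, h2, h3] with n h1 h2 h3 v
  have hS0 : 0 ≤ ∑ t ∈ Finset.range n, α t ^ 2 := Finset.sum_nonneg fun _ _ => sq_nonneg _
  simp only [Real.norm_eq_abs, abs_of_nonneg hS0, Nat.abs_cast] at h1 h2 h3
  refine le_trans ?_ (H α u w δ n hδ0.le hC ?_ h1 h2 h3 v)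
  · have : 0 ≤ ∑ i, v i ^ 2 := Finset.sum_nonneg fun _ _ => sq_nonneg _
    gcongr
  · simpa using Finset.sum_le_sum fun t (_ : t ∈ Finset.range n) => hα t

end

/-! ### The pricing model: perturbation sizes and the design matrix. -/

namespace PerturbedPricing

theorem sum_Icc_one_eq_sum_range {M : Type*} [AddCommMonoid M] (f : ℕ → M) (t : ℕ) :
    ∑ s ∈ Finset.Icc 1 t, f s = ∑ s ∈ Finset.range t, f (s + 1) := by
  rw [Finset.range_eq_Ico, Finset.sum_Ico_add' f 0 t 1]
  rfl

theorem perturbationSize_one (η : ℝ) : perturbationSize η 1 = 1 := by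
  simp [perturbationSize]

theorem perturbationSize_sq_le_one {η : ℝ} (hη : 0 ≤ η) (t : ℕ) :
    perturbationSize η (t + 1) ^ 2 ≤ 1 := by
  have h0 : 0 ≤ perturbationSize η (t + 1) := Real.rpow_nonneg (by positivity) _
  have h1 : perturbationSize η (t + 1) ≤ 1 :=
    Real.rpow_le_one_of_one_le_of_nonpos (by push_cast; linarith [t.cast_nonneg (α := ℝ)])
      (by linarith)
  exact pow_le_one₀ h0 h1

/-- Kronecker's lemma needs this divergence; it holds since the exponent `-2η` exceeds `-1`. -/
theorem tendsto_sum_perturbationSize_sq {η : ℝ} (hη : η < 1 / 2) :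
    Tendsto (fun n => ∑ t ∈ Finset.range n, perturbationSize η (t + 1) ^ 2) atTop atTop := by
  rw [← not_summable_iff_tendsto_nat_atTop_of_nonneg fun n => sq_nonneg _]
  have h : (fun t : ℕ => perturbationSize η t ^ 2) = fun t : ℕ => (t : ℝ) ^ (-η * 2) := by
    ext t
    rw [perturbationSize, ← Real.rpow_natCast, ← Real.rpow_mul t.cast_nonneg]
    norm_num
  intro hs
  have hs' := (summable_nat_add_iff (f := fun t : ℕ => perturbationSize η t ^ 2) 1).1 hs
  rw [h, Real.summable_nat_rpow] at hs'
  linarith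

section
variable {m k : ℕ} (η : ℝ) (pce : (Fin k → ℝ) → (Fin m ⊕ Fin k → ℝ) → (Fin m → ℝ))
  (c : ℕ → Fin k → ℝ) (u : ℕ → Fin m → ℝ) (βhat : ℕ → Fin m ⊕ Fin k → ℝ)

theorem isHermitian_designMatrix (t : ℕ) : (designMatrix η pce c u βhat t).IsHermitian := by
  ext i j
  simp [designMatrix, Matrix.sum_apply, Matrix.vecMulVec_apply, mul_comm]

/-- The unperturbed input `(p_ce(c_t; β̂_{t-1}), c_t)` of round `t + 1`. -/
noncomputable def unperturbedInput (t : ℕ) : Fin m ⊕ Fin k → ℝ :=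
  Sum.elim (pce (c (t + 1)) (βhat t)) (c (t + 1))

theorem dotProduct_designMatrix_mulVec (t : ℕ) (v : Fin m ⊕ Fin k → ℝ) :
    v ⬝ᵥ designMatrix η pce c u βhat t *ᵥ v =
      ∑ s ∈ Finset.range t, (v ⬝ᵥ unperturbedInput pce c βhat s +
        perturbationSize η (s + 1) * ((v ∘ Sum.inl) ⬝ᵥ u (s + 1))) ^ 2 := by
  rw [designMatrix, sum_Icc_one_eq_sum_range, Matrix.sum_mulVec, dotProduct_sum]
  refine Finset.sum_congr rfl fun s _ => ?_
  have h : v ⬝ᵥ input η pce c u βhat (s + 1) = v ⬝ᵥ unperturbedInput pce c βhat s +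
      perturbationSize η (s + 1) * ((v ∘ Sum.inl) ⬝ᵥ u (s + 1)) := by
    simp only [dotProduct, input, unperturbedInput, price, Fintype.sum_sum_type, Sum.elim_inl,
      Sum.elim_inr, Pi.add_apply, Pi.smul_apply, smul_eq_mul, mul_add, Finset.sum_add_distrib,
      Finset.mul_sum, Nat.add_sub_cancel, Function.comp_apply]
    rw [add_right_comm]
    congr 1
    exact Finset.sum_congr rfl fun i _ => by ring
  rw [Matrix.vecMulVec_mulVec, op_smul_eq_smul, dotProduct_smul, dotProduct_comm _ v, smul_eq_mul,
    h, sq]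

end

/-! ### Almost sure limit laws for the three empirical moments. -/

namespace IsModel
variable {Ω : Type*} [mΩ : MeasurableSpace Ω] {P : Measure Ω}
  {ℱ : Filtration ℕ mΩ} {m k : ℕ} {contexts : Set (Fin k → ℝ)} {params : Set (Fin m ⊕ Fin k → ℝ)}
  {c : ℕ → Ω → Fin k → ℝ} {u : ℕ → Ω → Fin m → ℝ} {βhat : ℕ → Ω → Fin m ⊕ Fin k → ℝ}

theorem exists_perturbation_bound (h : IsModel P ℱ contexts params c u βhat) :
    ∃ D, 0 ≤ D ∧ ∀ t, ∀ᵐ ω ∂P, ∀ i, |u (t + 1) ω i| ≤ D := by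
  obtain ⟨D, hD⟩ := h.perturbation_bounded
  refine ⟨max D 0, le_max_right _ _, fun t => ?_⟩
  have := (h.perturbation_identDistrib t).symm.ae_snd (p := fun x => ‖x‖ ≤ D)
    (measurableSet_le measurable_norm measurable_const) hD
  filter_upwards [this] with ω hω i
  exact (norm_le_pi_norm (u (t + 1) ω) i).trans (hω.trans (le_max_left _ _))

/-- The information available when the perturbation of round `t + 1` is drawn. -/
abbrev preInfo (ℱ : Filtration ℕ mΩ) (c : ℕ → Ω → Fin k → ℝ) (t : ℕ) : MeasurableSpace Ω :=
  ℱ t ⊔ MeasurableSpace.comap (c (t + 1)) inferInstance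

theorem preInfo_le (h : IsModel P ℱ contexts params c u βhat) (t : ℕ) :
    preInfo ℱ c t ≤ ℱ (t + 1) :=
  sup_le (ℱ.mono t.le_succ) (h.context_adapted t).comap_le

theorem measurable_unperturbedInput (h : IsModel P ℱ contexts params c u βhat)
    {pce : (Fin k → ℝ) → (Fin m ⊕ Fin k → ℝ) → (Fin m → ℝ)}
    (hpce : Measurable (Function.uncurry pce)) (t : ℕ) (j : Fin m ⊕ Fin k) :
    Measurable[preInfo ℱ c t]
      fun ω => unperturbedInput pce (fun s => c s ω) (fun s => βhat s ω) t j := by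
  have hc : Measurable[preInfo ℱ c t] (c (t + 1)) :=
    (comap_measurable _).mono le_sup_right le_rfl
  have hβ : Measurable[preInfo ℱ c t] (βhat t) :=
    (h.estimate_adapted t).mono le_sup_left le_rfl
  cases j with
  | inl i => exact (measurable_pi_apply i).comp (hpce.comp (hc.prodMk hβ))
  | inr i => exact (measurable_pi_apply i).comp hc

/-- The unperturbed input is known at stage `preInfo`, while the perturbation is centred and
independent of it. Nothing about how the estimates are computed matters. -/
theorem ae_isLittleO_cross [IsProbabilityMeasure P]
    (h : IsModel P ℱ contexts params c u βhat)
    {pce : (Fin k → ℝ) → (Fin m ⊕ Fin k → ℝ) → (Fin m → ℝ)}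
    (hpce : Measurable (Function.uncurry pce)) {C : ℝ}
    (hC : ∀ t, ∀ᵐ ω ∂P, ∀ j,
      |unperturbedInput pce (fun s => c s ω) (fun s => βhat s ω) t j| ≤ C)
    {η : ℝ} (hη : η < 1 / 2) (i : Fin m) (j : Fin m ⊕ Fin k) :
    ∀ᵐ ω ∂P, (fun n => ∑ t ∈ Finset.range n, perturbationSize η (t + 1) *
        (u (t + 1) ω i * unperturbedInput pce (fun s => c s ω) (fun s => βhat s ω) t j)) =o[atTop]
      fun n => ∑ t ∈ Finset.range n, perturbationSize η (t + 1) ^ 2 := by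
  obtain ⟨D, -, hD⟩ := h.exists_perturbation_bound
  have hz : ∀ t, Measurable[ℱ (t + 1)] fun ω => u (t + 1) ω i := fun t =>
    (measurable_pi_apply i).comp (h.perturbation_adapted t)
  have := ae_isLittleO_weighted_sum_of_indep (P := P) (ℱ := ℱ) (𝒢 := preInfo ℱ c)
    (w := fun t ω => unperturbedInput pce (fun s => c s ω) (fun s => βhat s ω) t j)
    (z := fun t ω => u (t + 1) ω i) (C := C) (D := D)
    (fun t => le_sup_left) h.preInfo_le (fun t => h.measurable_unperturbedInput hpce t j) hz
    (fun t => indep_of_indep_of_le_left (h.perturbation_indep t)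
      ((measurable_pi_apply i).comp (comap_measurable (u (t + 1)))).comap_le)
    (fun t => (hC t).mono fun ω hω => hω j) (fun t => (hD t).mono fun ω hω => hω i)
    (fun t => by
      rw [← h.perturbation_mean_zero i]
      exact ((h.perturbation_identDistrib t).comp (measurable_pi_apply i)).integral_eq)
    (a := fun t => perturbationSize η (t + 1)) (g := fun t => perturbationSize η (t + 1) ^ 2)
    (fun t => sq_nonneg _) (by simp [perturbationSize_one]) (fun t => le_rfl)
    (tendsto_sum_perturbationSize_sq hη)
  filter_upwards [this] with ω hω
  simpa only [mul_comm (u _ ω i)] using hω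

/-- The weighted strong law with weights `α²`, admissible because `α⁴ ≤ α²`. -/
theorem ae_isLittleO_perturbation [IsProbabilityMeasure P]
    (h : IsModel P ℱ contexts params c u βhat)
    {η : ℝ} (hη0 : 0 ≤ η) (hη : η < 1 / 2) (i j : Fin m) :
    ∀ᵐ ω ∂P, (fun n => ∑ t ∈ Finset.range n, perturbationSize η (t + 1) ^ 2 *
        (u (t + 1) ω i * u (t + 1) ω j - secondMoment P (u 1) i j)) =o[atTop]
      fun n => ∑ t ∈ Finset.range n, perturbationSize η (t + 1) ^ 2 := by
  obtain ⟨D, hD0, hD⟩ := h.exists_perturbation_bound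
  set M := secondMoment P (u 1) i j with hM
  have hφ : Measurable fun x : Fin m → ℝ => x i * x j - M := by fun_prop
  have hz : ∀ t, Measurable[ℱ (t + 1)] fun ω => u (t + 1) ω i * u (t + 1) ω j - M := fun t =>
    hφ.comp (h.perturbation_adapted t)
  have hint : Integrable (fun ω => u 1 ω i * u 1 ω j) P := by
    have hm : Measurable fun ω => u 1 ω i * u 1 ω j :=
      (by fun_prop : Measurable fun x : Fin m → ℝ => x i * x j).comp
        ((h.perturbation_adapted 0).mono (ℱ.le _) le_rfl)
    refine Integrable.of_bound hm.aestronglyMeasurable (D * D) ?_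
    filter_upwards [hD 0] with ω hω
    rw [norm_mul]
    exact mul_le_mul (hω i) (hω j) (norm_nonneg _) hD0
  have := ae_isLittleO_weighted_sum_of_indep (P := P) (ℱ := ℱ) (𝒢 := preInfo ℱ c)
    (w := fun _ _ => 1) (z := fun t ω => u (t + 1) ω i * u (t + 1) ω j - M)
    (C := 1) (D := D * D + |M|)
    (fun t => le_sup_left) h.preInfo_le (fun t => measurable_const) hz
    (fun t => indep_of_indep_of_le_left (h.perturbation_indep t)
      (hφ.comp (comap_measurable (u (t + 1)))).comap_le)
    (fun t => by simp)
    (fun t => (hD t).mono fun ω hω => by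
      refine (abs_sub _ _).trans (add_le_add_left ?_ _)
      rw [abs_mul]
      exact mul_le_mul (hω i) (hω j) (abs_nonneg _) hD0)
    (fun t => by
      have h1 : ∫ ω, (u (t + 1) ω i * u (t + 1) ω j - M) ∂P = ∫ ω, (u 1 ω i * u 1 ω j - M) ∂P :=
        ((h.perturbation_identDistrib t).comp hφ).integral_eq
      rw [h1, integral_sub hint (integrable_const _)]
      simp [hM, secondMoment])
    (a := fun t => perturbationSize η (t + 1) ^ 2) (g := fun t => perturbationSize η (t + 1) ^ 2)
    (fun t => sq_nonneg _) (by simp [perturbationSize_one])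
    (fun t => pow_le_of_le_one (sq_nonneg _) (perturbationSize_sq_le_one hη0 t) two_ne_zero)
    (tendsto_sum_perturbationSize_sq hη)
  simpa only [one_mul] using this

/-- The classical strong law for the i.i.d. bounded products of context coordinates. -/
theorem ae_isLittleO_context [IsProbabilityMeasure P]
    (h : IsModel P ℱ contexts params c u βhat)
    (hcontexts : Bornology.IsBounded contexts) (i j : Fin k) :
    ∀ᵐ ω ∂P, (fun n => ∑ t ∈ Finset.range n,
        (c (t + 1) ω i * c (t + 1) ω j - secondMoment P (c 1) i j)) =o[atTop]
      fun n => (n : ℝ) := by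
  obtain ⟨C, hC⟩ := hcontexts.exists_norm_le
  have hφ : Measurable fun x : Fin k → ℝ => x i * x j := by fun_prop
  have hint : Integrable (fun ω => c 1 ω i * c 1 ω j) P := by
    have hm := hφ.comp ((h.context_adapted 0).mono (ℱ.le _) le_rfl)
    refine Integrable.of_bound hm.aestronglyMeasurable (C * C) ?_
    filter_upwards [h.context_mem 0] with ω hω
    rw [norm_mul]
    have h0 := hC _ hω
    exact mul_le_mul ((norm_le_pi_norm _ i).trans h0) ((norm_le_pi_norm _ j).trans h0)
      (norm_nonneg _) ((norm_nonneg _).trans h0)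
  have := strong_law_ae_real (fun t ω => c (t + 1) ω i * c (t + 1) ω j) hint
    (fun s t hst => (h.context_indep.indepFun hst).comp hφ hφ)
    (fun t => (h.context_identDistrib t).comp hφ)
  filter_upwards [this] with ω hω
  refine (isLittleO_iff_tendsto' ?_).2 ?_
  · filter_upwards [eventually_gt_atTop 0] with n hn h0
    simp at h0; omega
  · have h1 := hω.sub_const (secondMoment P (c 1) i j)
    have h2 : ∫ ω, c 1 ω i * c 1 ω j ∂P = secondMoment P (c 1) i j := rfl
    simp only [zero_add, h2, sub_self] at h1
    refine h1.congr' ?_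
    filter_upwards [eventually_gt_atTop 0] with n hn
    have : (n : ℝ) ≠ 0 := by positivity
    rw [Finset.sum_sub_distrib]
    simp only [Finset.sum_const, Finset.card_range, nsmul_eq_mul]
    field_simp

theorem ae_abs_unperturbedInput_le (h : IsModel P ℱ contexts params c u βhat)
    {prices : Set (Fin m → ℝ)} (hprices : Bornology.IsBounded prices)
    (hcontexts : Bornology.IsBounded contexts)
    {r : (Fin m → ℝ) → (Fin k → ℝ) → (Fin m ⊕ Fin k → ℝ) → ℝ}
    {pce : (Fin k → ℝ) → (Fin m ⊕ Fin k → ℝ) → (Fin m → ℝ)}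
    (hpce : IsCertaintyEquivalentPrice prices contexts params r pce) :
    ∃ C, ∀ t, ∀ᵐ ω ∂P, ∀ j,
      |unperturbedInput pce (fun s => c s ω) (fun s => βhat s ω) t j| ≤ C := by
  obtain ⟨C, hC⟩ := hcontexts.exists_norm_le
  obtain ⟨C', hC'⟩ := hprices.exists_norm_le
  refine ⟨max C' C, fun t => ?_⟩
  filter_upwards [h.context_mem t, h.estimate_mem t] with ω hc hβ j
  cases j with
  | inl i => exact (norm_le_pi_norm _ i).trans ((hC' _ (hpce _ hc _ hβ).1).trans (le_max_left _ _))
  | inr i => exact (norm_le_pi_norm _ i).trans ((hC _ hc).trans (le_max_right _ _))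

end IsModel

end PerturbedPricing

/-! ### Assembly. -/

theorem proposition2 {Ω : Type*} [mΩ : MeasurableSpace Ω] (P : Measure Ω) [IsProbabilityMeasure P]
    (ℱ : Filtration ℕ mΩ) {m k : ℕ} (hd : 0 < m + k)
    (prices : Set (Fin m → ℝ)) (contexts : Set (Fin k → ℝ)) (params : Set (Fin m ⊕ Fin k → ℝ))
    (hprices : Bornology.IsBounded prices) (hcontexts : Bornology.IsBounded contexts)
    (r : (Fin m → ℝ) → (Fin k → ℝ) → (Fin m ⊕ Fin k → ℝ) → ℝ)
    (pce : (Fin k → ℝ) → (Fin m ⊕ Fin k → ℝ) → (Fin m → ℝ))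
    (hpce : PerturbedPricing.IsCertaintyEquivalentPrice prices contexts params r pce)
    (hpce_meas : Measurable (Function.uncurry pce))
    (c : ℕ → Ω → Fin k → ℝ) (u : ℕ → Ω → Fin m → ℝ) (βhat : ℕ → Ω → Fin m ⊕ Fin k → ℝ)
    (hmodel : PerturbedPricing.IsModel P ℱ contexts params c u βhat)
    (η : ℝ) (hη0 : 0 ≤ η) (hη1 : η < 1 / 2) :
    ∃ K : ℝ, 0 < K ∧ ∀ᵐ ω ∂P, ∃ T₀ : ℕ, ∀ t ≥ T₀,
      K * ∑ s ∈ Finset.Icc 1 t, PerturbedPricing.perturbationSize η s ^ 2 ≤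
        PerturbedPricing.minEigenvalue
          (PerturbedPricing.designMatrix η pce (fun s => c s ω) (fun s => u s ω)
            (fun s => βhat s ω) t) := by
  obtain ⟨C, hC⟩ := hmodel.ae_abs_unperturbedInput_le hprices hcontexts hpce
  -- `K` depends only on the two moment matrices and `C`, and is fixed before `ω`: hence
  -- deterministic.
  obtain ⟨K, hK, H⟩ := eventually_le_sum_dotProduct_perturbed_sq hmodel.perturbation_posDef
    hmodel.context_posDef C
  -- For `d = 0` the spectrum would be empty and `sInf ∅ = 0` would not bound the sum.
  have : Nonempty (Fin m ⊕ Fin k) := Fintype.card_pos_iff.1 (by simpa using hd)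
  refine ⟨K, hK, ?_⟩
  have h1 := ae_all_iff.2 fun i => ae_all_iff.2 fun j =>
    hmodel.ae_isLittleO_cross hpce_meas hC hη1 i j
  have h2 := ae_all_iff.2 fun i => ae_all_iff.2 fun j =>
    hmodel.ae_isLittleO_perturbation hη0 hη1 i j
  have h3 := ae_all_iff.2 fun i => ae_all_iff.2 fun j =>
    hmodel.ae_isLittleO_context hcontexts i j
  filter_upwards [ae_all_iff.2 hC, h1, h2, h3] with ω hω h1 h2 h3
  obtain ⟨T₀, hT₀⟩ := eventually_atTop.1 (H (fun t => PerturbedPricing.perturbationSize η (t + 1))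
    (fun t => u (t + 1) ω)
    (PerturbedPricing.unperturbedInput pce (fun s => c s ω) (fun s => βhat s ω))
    (fun t i => hω t (.inl i)) (PerturbedPricing.perturbationSize_sq_le_one hη0) h1 h2 h3)
  refine ⟨T₀, fun t ht => ?_⟩
  refine PerturbedPricing.le_minEigenvalue
    (PerturbedPricing.isHermitian_designMatrix η pce _ _ _ t) fun v => ?_
  rw [PerturbedPricing.dotProduct_designMatrix_mulVec, PerturbedPricing.sum_Icc_one_eq_sum_range]
  exact hT₀ t ht v
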